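/- Let $\Omega$ be a complete separable metric space, let $\mathcal H=C_{b.\mathrm{Lip}}(\Omega)$ be the space of bounded Lipschitz functions on $\Omega$, and let $\hat{\mathbb E}:\mathcal H\to\mathbb R$ be a regular sublinear expectation: it is monotone, constant-preserving, subadditive and positively homogeneous, and $f_k\downarrow 0$ pointwise implies $\hat{\mathbb E}[f_k]\downarrow 0$. Let $\mathcal P$ be a convex, weakly compact set of Borel probability measures on $\Omega$ with $\hat{\mathbb E}[f]=\sup_{P\in\mathcal P}E_P[f]$ for all $f\in\mathcal H$, and let $\hat V(A)=\sup_{P\in\mathcal P}P(A)$ be the upper capacity. Let $L^p(\Omega)$ be the completion of $\mathcal H$ under $\|X\|_p=\hat{\mathbb E}[|X|^p]^{1/p}$, realized as a space of Borel functions up to equality $P$-a.s. for all $P\in\mathcal P$, and extend $\hat{\mathbb E}$ to $L^1(\Omega)$ by $\hat{\mathbb E}[X]=\sup_{P\in\mathcal P}E_P[X]$. Let $n\ge 1$ and let $X_1,\dots,X_n\in L^2(\Omega;\mathbb R^d)$ be independent under $\hat{\mathbb E}$, that is, for each $1\le i\le n-1$ and each $\psi\in C_{b.\mathrm{Lip}}(\mathbb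 R^{d(i+1)})$, $$\hat{\mathbb E}[\psi(X_1,\dots,X_i,X_{i+1})]=\hat{\mathbb E}\Bigl[\hat{\mathbb E}[\psi(x_1,\dots,x_i,X_{i+1})]\big|_{(x_1,\dots,x_i)=(X_1,\dots,X_i)}\Bigr].$$ Let $M>0$ and suppose that, for every $i$, $|X_i|\le M$ $P$-a.s. for every $P\in\mathcal P$. Put $$\Theta_i=\{\theta\in\mathbb R^d:\langle\theta,p\rangle\le\hat{\mathbb E}[\langle p,X_i\rangle]\text{ for all }p\in\mathbb R^d\},\qquad \Theta=\Bigl\{\tfrac1n\sum_{i=1}^n\theta_i:\theta_i\in\Theta_i\Bigr\},\qquad \rho_\Theta(x)=\inf_{\theta\in\Theta}|x-\theta|.$$ Then for every $t>0$, $$\hat V\Bigl(\rho_\Theta\Bigl(\frac1n\sum_{i=1}^nX_i\Bigr)>t\Bigr)\le 2\cdot 5^d\,\exp\Bigl(-\frac{nt^2}{32M^2}\Bigr).$$ -/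

import Mathlib

open MeasureTheory Filter Topology
open scoped ENNReal NNReal

noncomputable section

namespace SublinearExp

/-- The vector space `C_{b.Lip}(S)` of bounded Lipschitz real functions on a metric space `S`,
with the pointwise order. -/
def BddLip (S : Type*) [PseudoMetricSpace S] : Submodule ℝ (S → ℝ) where
  carrier := {f | (∃ K : ℝ≥0, LipschitzWith K f) ∧ ∃ C : ℝ, ∀ x, |f x| ≤ C}
  add_mem' := by
    rintro f g ⟨⟨K, hK⟩, C, hC⟩ ⟨⟨L, hL⟩, D, hD⟩
    exact ⟨⟨K + L, hK.add hL⟩, C + D, fun x =>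
      (abs_add_le (f x) (g x)).trans (add_le_add (hC x) (hD x))⟩
  zero_mem' := ⟨⟨0, LipschitzWith.const 0⟩, 0, fun _ => by simp⟩
  smul_mem' := by
    rintro c f ⟨⟨K, hK⟩, C, hC⟩
    refine ⟨⟨‖c‖₊ * K, LipschitzWith.of_dist_le_mul fun x y => ?_⟩, |c| * C, fun x => ?_⟩
    · have h := mul_le_mul_of_nonneg_left (hK.dist_le_mul x y) (abs_nonneg c)
      simpa [Real.dist_eq, ← mul_sub, abs_mul, mul_assoc] using h
    · simpa [abs_mul] using mul_le_mul_of_nonneg_left (hC x) (abs_nonneg c)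

/-- The constant function `c` as an element of `C_{b.Lip}(S)`. -/
def BddLip.const (S : Type*) [PseudoMetricSpace S] (c : ℝ) : BddLip S :=
  ⟨fun _ => c, ⟨0, LipschitzWith.const c⟩, |c|, fun _ => le_rfl⟩

/-- A regular sublinear expectation on `C_{b.Lip}(Ω)`. -/
structure RegularSublinearExpectation (Ω : Type*) [PseudoMetricSpace Ω] where
  /-- the functional -/
  toFun : BddLip Ω → ℝ
  monotone : ∀ f g : BddLip Ω, f ≤ g → toFun f ≤ toFun g
  const : ∀ c : ℝ, toFun (BddLip.const Ω c) = c
  subadditive : ∀ f g : BddLip Ω, toFun (f + g) ≤ toFun f + toFun g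
  pos_homogeneous : ∀ (c : ℝ) (f : BddLip Ω), 0 ≤ c → toFun (c • f) = c * toFun f
  regular : ∀ f : ℕ → BddLip Ω, Antitone f →
    (∀ ω, Tendsto (fun k => (f k : Ω → ℝ) ω) atTop (𝓝 0)) →
    Tendsto (fun k => toFun (f k)) atTop (𝓝 0)

section Space

variable {Ω : Type*} [MetricSpace Ω] [MeasurableSpace Ω]

/-- `𝔓` is a convex and weakly compact set of Borel probability measures representing `𝔼`:
`𝔼[f] = sup_{P ∈ 𝔓} E_P[f]` for all `f ∈ C_{b.Lip}(Ω)`.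
(The topology of `ProbabilityMeasure Ω` is the topology of weak convergence.) -/
structure RegularSublinearExpectation.IsRepresentedBy [OpensMeasurableSpace Ω]
    (𝔼 : RegularSublinearExpectation Ω) (𝔓 : Set (ProbabilityMeasure Ω)) : Prop where
  convex : ∀ P ∈ 𝔓, ∀ Q ∈ 𝔓, ∀ a b : ℝ≥0, a + b = 1 →
    ∃ R ∈ 𝔓, (R : Measure Ω) = a • (P : Measure Ω) + b • (Q : Measure Ω)
  isCompact : IsCompact 𝔓
  isLUB : ∀ f : BddLip Ω,
    IsLUB ((fun P : ProbabilityMeasure Ω => ∫ ω, (f : Ω → ℝ) ω ∂(P : Measure Ω)) '' 𝔓)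
      (𝔼.toFun f)

/-- The upper capacity `V̂(A) = sup_{P ∈ 𝔓} P(A)`. -/
def upperCapacity (𝔓 : Set (ProbabilityMeasure Ω)) (A : Set Ω) : ℝ≥0∞ :=
  ⨆ P ∈ 𝔓, (P : Measure Ω) A

/-- A property holds almost surely (quasi-surely) if it holds `P`-a.s. for every `P ∈ 𝔓`. -/
def AlmostSurely (𝔓 : Set (ProbabilityMeasure Ω)) (p : Ω → Prop) : Prop :=
  ∀ P ∈ 𝔓, ∀ᵐ ω ∂(P : Measure Ω), p ω

/-- The sublinear expectation `sup_{P ∈ 𝔓} E_P[X]`, the extension to `L¹(Ω)` of the sublinear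
expectation on `C_{b.Lip}(Ω)` represented by `𝔓`. -/
def upperExpectation (𝔓 : Set (ProbabilityMeasure Ω)) (X : Ω → ℝ) : ℝ :=
  sSup ((fun P : ProbabilityMeasure Ω => ∫ ω, X ω ∂(P : Measure Ω)) '' 𝔓)

theorem upperExpectation_coe [OpensMeasurableSpace Ω] {𝔼 : RegularSublinearExpectation Ω}
    {𝔓 : Set (ProbabilityMeasure Ω)} (h : 𝔼.IsRepresentedBy 𝔓) (f : BddLip Ω) :
    upperExpectation 𝔓 (f : Ω → ℝ) = 𝔼.toFun f := by
  refine (h.isLUB f).csSup_eq (Set.Nonempty.image _ ?_)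
  rw [Set.nonempty_iff_ne_empty]
  rintro rfl
  have h1 := h.isLUB (BddLip.const Ω 0)
  rw [Set.image_empty, isLUB_empty_iff] at h1
  exact absurd (h1 (𝔼.toFun (BddLip.const Ω 0) - 1)) (by linarith)

/-- Membership in `L^p(Ω)`, the completion of `C_{b.Lip}(Ω)` under
`‖X‖_p = 𝔼[|X|^p]^{1/p} = sup_{P ∈ 𝔓} ‖X‖_{L^p(P)}`, realized as usual as the space of those
Borel functions (up to quasi-sure equality) that are limits in this norm of bounded Lipschitz
functions. -/
def MemL (𝔓 : Set (ProbabilityMeasure Ω)) (p : ℝ≥0∞) (X : Ω → ℝ) : Prop :=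
  Measurable X ∧ ∀ ε : ℝ≥0∞, 0 < ε → ∃ f : BddLip Ω, ∀ P ∈ 𝔓,
    eLpNorm (fun ω => X ω - (f : Ω → ℝ) ω) p (P : Measure Ω) ≤ ε

/-- Membership in `L^p(Ω; ℝ^d)`: every coordinate is in `L^p(Ω)`. -/
def MemLVec {d : ℕ} (𝔓 : Set (ProbabilityMeasure Ω)) (p : ℝ≥0∞)
    (X : Ω → EuclideanSpace ℝ (Fin d)) : Prop :=
  ∀ k : Fin d, MemL 𝔓 p (fun ω => X ω k)

/-- Independence of `X_0, …, X_{n-1}` under the sublinear expectation: for each `0 < i < n`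
and each bounded Lipschitz `ψ`,
`𝔼[ψ(X_0, …, X_{i-1}, X_i)] = 𝔼[𝔼[ψ(x_0, …, x_{i-1}, X_i)]|_{x = (X_0, …, X_{i-1})}]`. -/
def Independent {n d : ℕ} (𝔓 : Set (ProbabilityMeasure Ω))
    (X : Fin n → Ω → EuclideanSpace ℝ (Fin d)) : Prop :=
  ∀ i : Fin n, 0 < (i : ℕ) →
    ∀ ψ : BddLip ((Fin (i : ℕ) → EuclideanSpace ℝ (Fin d)) × EuclideanSpace ℝ (Fin d)),
      upperExpectation 𝔓
          (fun ω => (ψ : _ → ℝ) (fun j => X (Fin.castLE i.isLt.le j) ω, X i ω)) =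
        upperExpectation 𝔓 (fun ω => upperExpectation 𝔓
          (fun ω' => (ψ : _ → ℝ) (fun j => X (Fin.castLE i.isLt.le j) ω, X i ω')))

/-- The expectation set of `X`: the convex compact set whose support function is
`p ↦ 𝔼[⟨p, X⟩]`. -/
def expectationSet {d : ℕ} (𝔓 : Set (ProbabilityMeasure Ω))
    (X : Ω → EuclideanSpace ℝ (Fin d)) : Set (EuclideanSpace ℝ (Fin d)) :=
  {θ | ∀ p : EuclideanSpace ℝ (Fin d),
    inner ℝ θ p ≤ upperExpectation 𝔓 (fun ω => inner ℝ p (X ω))}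

/-- The Minkowski average `Θ = {(1/n) ∑ θ_i : θ_i ∈ Θ_i}` of the expectation sets. -/
def minkowskiAverage {n d : ℕ} (𝔓 : Set (ProbabilityMeasure Ω))
    (X : Fin n → Ω → EuclideanSpace ℝ (Fin d)) : Set (EuclideanSpace ℝ (Fin d)) :=
  {x | ∃ θ : Fin n → EuclideanSpace ℝ (Fin d),
    (∀ i, θ i ∈ expectationSet 𝔓 (X i)) ∧ x = (1 / (n : ℝ)) • ∑ i, θ i}

end Space

end SublinearExp

end

/-!
The bound is proved for each `P ∈ 𝔓` separately, by comparing the sample mean with a random point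
of the set `Θ = minkowskiAverage 𝔓 X`.

Let `θ i = E_P[X i | X 0, …, X (i - 1)]`. With `𝔼` for `upperExpectation 𝔓`, independence says
that, for a nonnegative bounded Lipschitz function `φ` of the earlier variables, the upper
expectation of `φ * (⟨p, X i⟩ - 𝔼[⟨p, X i⟩])` is zero
(`Independent.integral_mul_inner_sub_nonpos`; the linear form may be truncated since `X i` is
bounded). The expectation under `P` is therefore nonpositive, and since such `φ` suffice to test
conditional expectations (`condExp_comap_le_of_forall_bddLip`), `⟨p, θ i⟩ ≤ 𝔼[⟨p, X i⟩]` holds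
`P`-a.s. Running `p` through a countable dense set shows that `θ i` lies in the expectation set of
`X i` (`Independent.condExp_mem_expectationSet`). Hence `(1/n) ∑ θ i ∈ Θ`, and the distance from
the sample mean to `Θ` is at most `(1/n) ‖∑ (X i - θ i)‖`.

The summands `X i - θ i` are martingale differences of norm at most `2 M`. A net of at most
`5 ^ d` unit ball vectors `q` with `‖v‖ ≤ 2 max ⟨q, v⟩` (`exists_finset_norm_le_two_mul_inner`)
reduces their sum to scalar martingales, to which the Azuma–Hoeffding inequality applies with
threshold `n t / 2` (`measure_lt_norm_sum_sub_condExp_le`). The exponent is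
`(n t / 2) ^ 2 / (2 n (2 M) ^ 2) = n t ^ 2 / (32 M ^ 2)`; the one-sided inequality is enough,
because the net controls the norm by inner products without absolute values.
-/

namespace SublinearExp

open ProbabilityTheory

/-! ### Finite nets in the unit ball -/

/-- At most `5 ^ dim E` vectors of the unit ball determine norms up to a factor `2`. They are half
the points of a maximal `1`-separated subset of the ball of radius `2`. -/
theorem exists_finset_norm_le_two_mul_inner (E : Type*) [NormedAddCommGroup E]
    [InnerProductSpace ℝ E] [FiniteDimensional ℝ E] :
    ∃ s : Finset E, s.card ≤ 5 ^ Module.finrank ℝ E ∧ (∀ q ∈ s, ‖q‖ ≤ 1) ∧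
      ∀ v : E, ∃ q ∈ s, ‖v‖ ≤ 2 * inner ℝ q v := by
  classical
  let S : Set (Finset E) := {s | (∀ c ∈ s, ‖c‖ ≤ 2) ∧ ∀ c ∈ s, ∀ e ∈ s, c ≠ e → 1 ≤ ‖c - e‖}
  have hbdd : BddAbove (Finset.card '' S) := by
    refine ⟨5 ^ Module.finrank ℝ E, ?_⟩
    rintro _ ⟨s, hs, rfl⟩
    exact Besicovitch.card_le_of_separated s hs.1 hs.2
  have hne : (Finset.card '' S).Nonempty := ⟨_, ∅, by simp [S], rfl⟩
  obtain ⟨s, hs, hcard⟩ := Nat.sSup_mem hne hbdd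
  -- By maximality, every point of the ball of radius `2` is within distance `1` of `s`.
  have hnet : ∀ u : E, ‖u‖ ≤ 2 → ∃ c ∈ s, ‖u - c‖ ≤ 1 := by
    intro u hu
    by_contra! hfar
    have hus : u ∉ s := fun h => absurd (hfar u h) (by simp)
    have hins : insert u s ∈ S := by
      refine ⟨fun c hc => ?_, fun c hc e he hce => ?_⟩
      · rcases Finset.mem_insert.1 hc with rfl | hc
        exacts [hu, hs.1 c hc]
      · rcases Finset.mem_insert.1 hc with rfl | hc <;> rcases Finset.mem_insert.1 he with rfl | he
        · exact absurd rfl hce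
        · exact (hfar e ‹_›).le
        · rw [norm_sub_rev]; exact (hfar c ‹_›).le
        · exact hs.2 c ‹_› e ‹_› hce
    have := le_csSup hbdd ⟨_, hins, rfl⟩
    rw [Finset.card_insert_of_notMem hus, ← hcard] at this
    omega
  refine ⟨s.image fun c => (2⁻¹ : ℝ) • c, Finset.card_image_le.trans
    (Besicovitch.card_le_of_separated s hs.1 hs.2), ?_, fun v => ?_⟩
  · intro q hq
    obtain ⟨c, hc, rfl⟩ := Finset.mem_image.1 hq
    have := hs.1 c hc
    rw [norm_smul, Real.norm_of_nonneg (by norm_num)]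
    linarith
  · obtain ⟨c, hc, hcu⟩ := hnet ((2 * ‖v‖⁻¹) • v) (by
      rw [norm_smul, Real.norm_of_nonneg (by positivity)]
      rcases eq_or_ne ‖v‖ 0 with h | h
      · simp [h]
      · rw [mul_assoc, inv_mul_cancel₀ h]; norm_num)
    refine ⟨_, Finset.mem_image_of_mem _ hc, ?_⟩
    rcases eq_or_ne ‖v‖ 0 with h | h
    · simp [norm_eq_zero.1 h]
    · have h1 : inner ℝ ((2 * ‖v‖⁻¹) • v - c) v ≤ ‖v‖ :=
        (real_inner_le_norm _ _).trans (by nlinarith [norm_nonneg v])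
      have h2 : inner ℝ ((2 * ‖v‖⁻¹) • v) v = 2 * ‖v‖ := by
        rw [real_inner_smul_left, real_inner_self_eq_norm_sq]; field_simp
      have h3 : inner ℝ ((2⁻¹ : ℝ) • c) v = 2⁻¹ * inner ℝ c v := real_inner_smul_left ..
      rw [inner_sub_left, h2] at h1
      rw [h3]; linarith

/-! ### The past of a sequence and the Azuma–Hoeffding inequality for vectors -/

section Past

variable {Ω E : Type*} [MeasurableSpace E]

/-- The vector `(Z 0, …, Z (k - 1))`. -/
def pastVector (Z : ℕ → Ω → E) (k : ℕ) (ω : Ω) : Fin k → E := fun j => Z j ω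

/-- The `σ`-algebra generated by `Z 0, …, Z (k - 1)`; note that `Z k` is not included. -/
abbrev past (Z : ℕ → Ω → E) (k : ℕ) : MeasurableSpace Ω :=
  MeasurableSpace.comap (pastVector Z k) inferInstance

variable {Z : ℕ → Ω → E}

theorem measurable_pastVector [MeasurableSpace Ω] (hZ : ∀ i, Measurable (Z i)) (k : ℕ) :
    Measurable (pastVector Z k) :=
  measurable_pi_lambda _ fun j => hZ j

theorem past_le {mΩ : MeasurableSpace Ω} (hZ : ∀ i, Measurable (Z i)) (k : ℕ) : past Z k ≤ mΩ :=
  (measurable_pastVector hZ k).comap_le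

theorem measurable_past {i k : ℕ} (hik : i < k) : Measurable[past Z k] (Z i) :=
  (measurable_pi_apply (⟨i, hik⟩ : Fin k)).comp (comap_measurable (pastVector Z k))

theorem past_mono : Monotone (past Z) := by
  intro k l hkl
  refine Measurable.comap_le (m₁ := past Z l) ?_
  exact @measurable_pi_lambda _ _ _ (past Z l) _ _ fun j => measurable_past (j.2.trans_le hkl)

/-- The filtration generated by `Z`, with `Z i` measurable at time `i`. -/
def pastFiltration {mΩ : MeasurableSpace Ω} (hZ : ∀ i, Measurable (Z i)) : Filtration ℕ mΩ where
  seq i := past Z (i + 1)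
  mono' _ _ h := past_mono (Nat.succ_le_succ h)
  le' _ := past_le hZ _

end Past

/-- Hoeffding's lemma for a symmetric range. -/
theorem hasSubgaussianMGF_of_abs_le_of_integral_eq_zero {Ω : Type*} {mΩ : MeasurableSpace Ω}
    {μ : Measure Ω} [IsProbabilityMeasure μ] {Y : Ω → ℝ} (hY : Measurable Y) {K : ℝ} (hK : 0 ≤ K)
    (hb : ∀ᵐ ω ∂μ, |Y ω| ≤ K) (h0 : ∫ ω, Y ω ∂μ = 0) :
    HasSubgaussianMGF Y (K.toNNReal ^ 2) μ := by
  convert hasSubgaussianMGF_of_mem_Icc_of_integral_eq_zero hY.aemeasurable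
    (hb.mono fun ω h => abs_le.1 h) h0 using 2
  ext
  rw [NNReal.coe_div, coe_nnnorm, Real.norm_of_nonneg (by linarith), Real.coe_toNNReal _ hK]
  simp

/-- Hoeffding's lemma, conditionally on a `σ`-algebra: the unconditional lemma is applied to the
regular conditional distributions. -/
theorem hasCondSubgaussianMGF_of_abs_le_of_condExp_eq_zero {Ω : Type*} {m mΩ : MeasurableSpace Ω}
    [StandardBorelSpace Ω] {μ : Measure Ω} [IsProbabilityMeasure μ]
    (hm : m ≤ mΩ) {Y : Ω → ℝ} (hY : Measurable Y) {K : ℝ} (hK : 0 ≤ K)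
    (hb : ∀ᵐ ω ∂μ, |Y ω| ≤ K) (h0 : μ[Y|m] =ᵐ[μ] 0) :
    HasCondSubgaussianMGF m hm Y (K.toNNReal ^ 2) μ := by
  have hb' : ∀ᵐ ω ∂μ, Y ω ∈ Set.Icc (-K) K := hb.mono fun ω h => abs_le.1 h
  have hint : Integrable Y μ := .of_mem_Icc _ _ hY.aemeasurable hb'
  refine ⟨fun t => ?_, ?_⟩
  · rw [condExpKernel_comp_trim]
    exact integrable_exp_mul_of_mem_Icc hY.aemeasurable hb'
  · have hb2 : ∀ᵐ ω ∂(μ.trim hm), ∀ᵐ ω' ∂(condExpKernel μ m ω), |Y ω'| ≤ K := by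
      apply Measure.ae_ae_of_ae_comp
      rwa [condExpKernel_comp_trim]
    have h02 : ∀ᵐ ω ∂(μ.trim hm), ∫ ω', Y ω' ∂(condExpKernel μ m ω) = 0 := by
      have h1 := condExp_ae_eq_trim_integral_condExpKernel hm hint
      have h2 : μ[Y|m] =ᵐ[μ.trim hm] 0 :=
        StronglyMeasurable.ae_eq_trim_of_stronglyMeasurable hm stronglyMeasurable_condExp
          stronglyMeasurable_zero h0
      filter_upwards [h1, h2] with ω h1 h2
      rw [← h1, h2]; rfl
    filter_upwards [hb2, h02] with ω hω h0ω t
    exact (hasSubgaussianMGF_of_abs_le_of_integral_eq_zero hY hK hω h0ω).mgf_le t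

/-- A vector-valued Azuma–Hoeffding inequality for the martingale obtained by subtracting from
each term its conditional mean given the past. The scalar inequality is applied to the inner
products with the vectors of a finite net, at the cost of half the threshold and a factor
`5 ^ dim E`. -/
theorem measure_lt_norm_sum_sub_condExp_le {Ω E : Type*} [MeasurableSpace Ω]
    [StandardBorelSpace Ω] {μ : Measure Ω} [IsProbabilityMeasure μ] [NormedAddCommGroup E]
    [InnerProductSpace ℝ E] [FiniteDimensional ℝ E] [MeasurableSpace E] [BorelSpace E]
    {Z : ℕ → Ω → E} (hZ : ∀ i, Measurable (Z i)) {M : ℝ} (hM : 0 < M)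
    (hb : ∀ i, ∀ᵐ ω ∂μ, ‖Z i ω‖ ≤ M) {n : ℕ} (hn : 0 < n) {t : ℝ} (ht : 0 < t) :
    μ.real {ω | n * t < ‖∑ i ∈ Finset.range n, (Z i ω - (μ[Z i|past Z i]) ω)‖} ≤
      5 ^ Module.finrank ℝ E * Real.exp (-(n * t ^ 2 / (32 * M ^ 2))) := by
  have hfin : ∀ i, Integrable (Z i) μ := fun i =>
    .of_bound (hZ i).aestronglyMeasurable M (hb i)
  obtain ⟨s, hcard, hs1, hs2⟩ := exists_finset_norm_le_two_mul_inner E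
  set Y : E → ℕ → Ω → ℝ := fun q i ω => inner ℝ q (Z i ω - (μ[Z i|past Z i]) ω)
  have hcm (i : ℕ) : Measurable[past Z i] (μ[Z i|past Z i]) :=
    stronglyMeasurable_condExp.measurable
  have hYm (q : E) (i : ℕ) : Measurable[past Z (i + 1)] (Y q i) := by
    have h1 : Measurable[past Z (i + 1)] (fun ω => Z i ω - (μ[Z i|past Z i]) ω) :=
      (measurable_past i.lt_succ_self).sub ((hcm i).mono (past_mono i.le_succ) le_rfl)
    exact (innerSL ℝ q).continuous.measurable.comp h1
  have hYm' (q : E) (i : ℕ) : Measurable (Y q i) := (hYm q i).mono (past_le hZ _) le_rfl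
  have hYb (q : E) (hq : ‖q‖ ≤ 1) (i : ℕ) : ∀ᵐ ω ∂μ, |Y q i ω| ≤ 2 * M := by
    filter_upwards [hb i, ae_bdd_norm_condExp_of_ae_bdd_norm (m := past Z i) (hb i)] with ω h1 h2
    calc |Y q i ω| ≤ ‖q‖ * ‖Z i ω - (μ[Z i|past Z i]) ω‖ := abs_real_inner_le_norm _ _
      _ ≤ 1 * (M + M) := by
        gcongr
        exact (norm_sub_le _ _).trans (add_le_add h1 h2)
      _ = 2 * M := by ring
  have hY0 (q : E) (i : ℕ) : μ[Y q i|past Z i] =ᵐ[μ] 0 := by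
    have h1 := (innerSL ℝ q).comp_condExp_comm (m := past Z i)
      ((hfin i).sub (integrable_condExp (m := past Z i) (f := Z i)))
    have h2 := condExp_sub (hfin i) (integrable_condExp (m := past Z i) (f := Z i)) (past Z i)
    have h3 := condExp_of_stronglyMeasurable (past_le hZ i) (stronglyMeasurable_condExp (μ := μ)
      (f := Z i) (m := past Z i)) integrable_condExp
    refine h1.symm.trans ?_
    filter_upwards [h2] with ω h2
    rw [h3] at h2
    simp [h2]
  have hq (q : E) (hq : q ∈ s) : μ.real {ω | n * t / 2 ≤ ∑ i ∈ Finset.range n, Y q i ω} ≤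
      Real.exp (-(n * t ^ 2 / (32 * M ^ 2))) := by
    have hsub (i : ℕ) := hasCondSubgaussianMGF_of_abs_le_of_condExp_eq_zero (past_le hZ i)
      (hYm' q i) (by positivity) (hYb q (hs1 q hq) i) (hY0 q i)
    have h00 : HasSubgaussianMGF (Y q 0) ((2 * M).toNNReal ^ 2) μ := by
      refine hasSubgaussianMGF_of_abs_le_of_integral_eq_zero (hYm' q 0) (by positivity)
        (hYb q (hs1 q hq) 0) ?_
      rw [← integral_condExp (past_le hZ 0), integral_congr_ae (hY0 q 0)]
      simp
    have := measure_sum_ge_le_of_hasCondSubgaussianMGF (ℱ := pastFiltration hZ)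
      (fun i => (hYm q i).stronglyMeasurable) h00 (cY := fun _ => (2 * M).toNNReal ^ 2) n
      (fun i _ => hsub (i + 1)) (ε := n * t / 2) (by positivity)
    refine this.trans_eq ?_
    have hn' : (n : ℝ) ≠ 0 := by positivity
    congr 1
    simp only [Finset.sum_const, Finset.card_range, nsmul_eq_mul, NNReal.coe_pow,
      Real.coe_toNNReal _ (by positivity : 0 ≤ 2 * M), NNReal.coe_mul, NNReal.coe_natCast]
    field_simp
    ring
  calc μ.real {ω | n * t < ‖∑ i ∈ Finset.range n, (Z i ω - (μ[Z i|past Z i]) ω)‖}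
      ≤ μ.real (⋃ q ∈ s, {ω | n * t / 2 ≤ ∑ i ∈ Finset.range n, Y q i ω}) := by
        refine measureReal_mono (fun ω hω => ?_) (measure_ne_top _ _)
        obtain ⟨q, hqs, hqv⟩ := hs2 (∑ i ∈ Finset.range n, (Z i ω - (μ[Z i|past Z i]) ω))
        simp only [Set.mem_iUnion]
        refine ⟨q, hqs, ?_⟩
        rw [inner_sum] at hqv
        have := lt_of_lt_of_le (show _ < _ from hω) hqv
        show n * t / 2 ≤ ∑ i ∈ Finset.range n, Y q i ω
        linarith
    _ ≤ ∑ q ∈ s, μ.real {ω | n * t / 2 ≤ ∑ i ∈ Finset.range n, Y q i ω} :=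
        measureReal_biUnion_finset_le _ _
    _ ≤ s.card • Real.exp (-(n * t ^ 2 / (32 * M ^ 2))) := Finset.sum_le_card_nsmul _ _ _ hq
    _ ≤ _ := by
        rw [nsmul_eq_mul]
        gcongr
        exact_mod_cast hcard

/-! ### Conditional expectations tested on bounded Lipschitz functions -/

theorem BddLip.mul_mem {S : Type*} [PseudoMetricSpace S] {f g : S → ℝ} (hf : f ∈ BddLip S)
    (hg : g ∈ BddLip S) : (fun x => f x * g x) ∈ BddLip S := by
  obtain ⟨⟨K, hK⟩, C, hC⟩ := hf
  obtain ⟨⟨L, hL⟩, D, hD⟩ := hg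
  refine ⟨⟨(C * L + K * D).toNNReal, LipschitzWith.of_dist_le_mul fun x y => ?_⟩, C * D,
    fun x => ?_⟩
  · have hC0 : 0 ≤ C := (abs_nonneg _).trans (hC x)
    have hD0 : 0 ≤ D := (abs_nonneg _).trans (hD x)
    have h1 := hK.dist_le_mul x y
    have h2 := hL.dist_le_mul x y
    rw [Real.dist_eq] at h1 h2 ⊢
    rw [Real.coe_toNNReal _ (by positivity)]
    calc |f x * g x - f y * g y| = |f x * (g x - g y) + (f x - f y) * g y| := by ring_nf
      _ ≤ |f x| * |g x - g y| + |f x - f y| * |g y| := by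
        rw [← abs_mul, ← abs_mul]; exact abs_add_le _ _
      _ ≤ C * (L * dist x y) + K * dist x y * D := by gcongr <;> apply_assumption
      _ = _ := by ring
  · rw [abs_mul]
    exact mul_le_mul (hC x) (hD x) (abs_nonneg _) ((abs_nonneg _).trans (hC x))

theorem BddLip.comp_mem {S T : Type*} [PseudoMetricSpace S] [PseudoMetricSpace T] {f : T → ℝ}
    (hf : f ∈ BddLip T) {g : S → T} {K : ℝ≥0} (hg : LipschitzWith K g) : f ∘ g ∈ BddLip S := by
  obtain ⟨⟨L, hL⟩, C, hC⟩ := hf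
  exact ⟨⟨_, hL.comp hg⟩, C, fun x => hC _⟩

theorem BddLip.thickenedIndicator_mem {S : Type*} [PseudoMetricSpace S] {δ : ℝ} (hδ : 0 < δ)
    (A : Set S) : (fun x => (thickenedIndicator hδ A x : ℝ)) ∈ BddLip S := by
  refine ⟨⟨_, (LipschitzWith.subtype_val _).comp (lipschitzWith_thickenedIndicator hδ A)⟩, 1,
    fun x => ?_⟩
  rw [abs_of_nonneg (by positivity)]
  exact_mod_cast thickenedIndicator_le_one hδ A x

section Test

variable {Ω S : Type*} [mΩ : MeasurableSpace Ω] {μ : Measure Ω} [PseudoMetricSpace S]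
  [MeasurableSpace S] [BorelSpace S] {W : Ω → S} {g : Ω → ℝ}

/-- The indicator of a closed set is a decreasing limit of nonnegative bounded Lipschitz
functions. -/
theorem setIntegral_preimage_isClosed_nonpos (hW : Measurable W) (hg : Integrable g μ)
    (h : ∀ φ : BddLip S, (∀ x, 0 ≤ (φ : S → ℝ) x) → ∫ ω, (φ : S → ℝ) (W ω) * g ω ∂μ ≤ 0)
    {F : Set S} (hF : IsClosed F) : ∫ ω in W ⁻¹' F, g ω ∂μ ≤ 0 := by
  have hpos (k : ℕ) : (0 : ℝ) < 1 / ((k : ℝ) + 1) := by positivity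
  have hlim := thickenedIndicator_tendsto_indicator_closure hpos
    tendsto_one_div_add_atTop_nhds_zero_nat F
  rw [hF.closure_eq, tendsto_pi_nhds] at hlim
  have key : Tendsto (fun k => ∫ ω, (thickenedIndicator (hpos k) F (W ω) : ℝ) * g ω ∂μ) atTop
      (𝓝 (∫ ω, (W ⁻¹' F).indicator g ω ∂μ)) := by
    refine tendsto_integral_of_dominated_convergence (fun ω => |g ω|) (fun k => ?_) hg.abs
      (fun k => ae_of_all _ fun ω => ?_) (ae_of_all _ fun ω => ?_)
    · have : Measurable fun ω => (thickenedIndicator (hpos k) F (W ω) : ℝ) :=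
        ((thickenedIndicator (hpos k) F).continuous.measurable.comp hW).coe_nnreal_real
      exact this.aestronglyMeasurable.mul hg.aestronglyMeasurable
    · rw [norm_mul, Real.norm_eq_abs, Real.norm_eq_abs, abs_of_nonneg (by positivity)]
      exact mul_le_of_le_one_left (abs_nonneg _)
        (by exact_mod_cast thickenedIndicator_le_one (hpos k) F _)
    · have h1 : Tendsto (fun k => (thickenedIndicator (hpos k) F (W ω) : ℝ)) atTop
          (𝓝 ((F.indicator (fun _ => (1 : ℝ≥0)) (W ω) : ℝ≥0) : ℝ)) :=
        (NNReal.continuous_coe.tendsto _).comp (hlim (W ω))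
      have h2 : (W ⁻¹' F).indicator g ω =
          ((F.indicator (fun _ => (1 : ℝ≥0)) (W ω) : ℝ≥0) : ℝ) * g ω := by
        by_cases hω : W ω ∈ F <;> simp [hω]
      rw [h2]
      exact h1.mul_const _
  rw [← integral_indicator (hW hF.measurableSet)]
  exact le_of_tendsto' key fun k =>
    h ⟨_, BddLip.thickenedIndicator_mem (hpos k) F⟩ fun x => NNReal.coe_nonneg _

/-- The bound on closed sets extends to Borel sets by inner regularity of the law of `W`. -/
theorem setIntegral_preimage_nonpos [IsFiniteMeasure μ] (hW : Measurable W) {K : ℝ}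
    (hg : AEStronglyMeasurable g μ) (hK : ∀ᵐ ω ∂μ, ‖g ω‖ ≤ K)
    (h : ∀ φ : BddLip S, (∀ x, 0 ≤ (φ : S → ℝ) x) → ∫ ω, (φ : S → ℝ) (W ω) * g ω ∂μ ≤ 0)
    {B : Set S} (hB : MeasurableSet B) : ∫ ω in W ⁻¹' B, g ω ∂μ ≤ 0 := by
  have hint : Integrable g μ := .of_bound hg K hK
  have hK' : 0 < |K| + 1 := by positivity
  refine le_of_forall_pos_le_add fun ε hε => ?_
  obtain ⟨F, hFB, hF, hlt⟩ := hB.exists_isClosed_sdiff_lt (μ := μ.map W) (measure_ne_top _ _)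
    (ε := ENNReal.ofReal (ε / (|K| + 1))) (by simpa using by positivity)
  rw [Measure.map_apply hW (hB.diff hF.measurableSet)] at hlt
  have hreal : μ.real (W ⁻¹' (B \ F)) ≤ ε / (|K| + 1) :=
    ENNReal.toReal_le_of_le_ofReal (by positivity) hlt.le
  have hsplit := setIntegral_sdiff (μ := μ) (f := g) (hW hF.measurableSet)
    hint.integrableOn (Set.preimage_mono (f := W) hFB)
  have h1 := setIntegral_preimage_isClosed_nonpos hW hint h hF
  have h2 : ‖∫ ω in W ⁻¹' B \ W ⁻¹' F, g ω ∂μ‖ ≤ (|K| + 1) * μ.real (W ⁻¹' (B \ F)) :=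
    norm_setIntegral_le_of_norm_le_const_ae' (measure_lt_top _ _)
      (hK.mono fun ω hω _ => hω.trans ((le_abs_self K).trans (by linarith)))
  have h3 : (|K| + 1) * μ.real (W ⁻¹' (B \ F)) ≤ ε := by
    rw [mul_comm]; exact (le_div_iff₀ hK').1 hreal
  have h4 := (le_abs_self _).trans (h2.trans h3)
  linarith

/-- An upper bound for a conditional expectation given `W` may be tested on nonnegative bounded
Lipschitz functions of `W`. -/
theorem condExp_comap_le_of_forall_bddLip [IsProbabilityMeasure μ] (hW : Measurable W) {K c : ℝ}
    {Y : Ω → ℝ} (hY : AEStronglyMeasurable Y μ) (hK : ∀ᵐ ω ∂μ, ‖Y ω‖ ≤ K)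
    (h : ∀ φ : BddLip S, (∀ x, 0 ≤ (φ : S → ℝ) x) →
      ∫ ω, (φ : S → ℝ) (W ω) * (Y ω - c) ∂μ ≤ 0) :
    ∀ᵐ ω ∂μ, (μ[Y | MeasurableSpace.comap W inferInstance]) ω ≤ c := by
  have hint : Integrable Y μ := .of_bound hY K hK
  have hm := hW.comap_le
  refine ae_le_of_ae_le_trim (hm := hm) (?_ : _ ≤ᵐ[μ.trim hm] fun _ => c)
  refine ae_le_of_forall_setIntegral_le
    (integrable_condExp.trim hm stronglyMeasurable_condExp) (integrable_const _) ?_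
  intro A hA _
  rw [← setIntegral_trim hm stronglyMeasurable_condExp hA,
    ← setIntegral_trim hm stronglyMeasurable_const hA, setIntegral_condExp hm hint hA]
  obtain ⟨B, hB, rfl⟩ := hA
  have := setIntegral_preimage_nonpos hW (g := fun ω => Y ω - c) (K := K + ‖c‖)
    (hY.sub aestronglyMeasurable_const)
    (hK.mono fun ω hω => (norm_sub_le _ _).trans (by gcongr)) h hB
  rw [integral_sub hint.integrableOn (integrable_const _)] at this
  linarith

end Test

/-! ### Finite sequences as infinite ones -/

/-- The sequence `X 0, …, X (n - 1)` continued by zeros. -/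
def extendZero {Ω : Type*} {n d : ℕ} (X : Fin n → Ω → EuclideanSpace ℝ (Fin d)) (j : ℕ) :
    Ω → EuclideanSpace ℝ (Fin d) :=
  if h : j < n then X ⟨j, h⟩ else 0

theorem extendZero_coe {Ω : Type*} {n d : ℕ} (X : Fin n → Ω → EuclideanSpace ℝ (Fin d)) (i : Fin n) :
    extendZero X i = X i := by
  simp [extendZero]

/-! ### Upper expectations -/

section Upper

variable {Ω : Type*} [MeasurableSpace Ω] {𝔓 : Set (ProbabilityMeasure Ω)}

theorem abs_integral_le_of_almostSurely {f : Ω → ℝ} {C : ℝ}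
    (hf : AlmostSurely 𝔓 fun ω => |f ω| ≤ C) {P : ProbabilityMeasure Ω} (hP : P ∈ 𝔓) :
    |∫ ω, f ω ∂(P : Measure Ω)| ≤ C := by
  simpa using norm_integral_le_of_norm_le_const (μ := (P : Measure Ω)) (f := f) (hf P hP)

theorem bddAbove_image_integral {f : Ω → ℝ} {C : ℝ} (hf : AlmostSurely 𝔓 fun ω => |f ω| ≤ C) :
    BddAbove ((fun P : ProbabilityMeasure Ω => ∫ ω, f ω ∂(P : Measure Ω)) '' 𝔓) := by
  refine ⟨C, ?_⟩
  rintro _ ⟨P, hP, rfl⟩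
  exact (abs_le.1 (abs_integral_le_of_almostSurely hf hP)).2

theorem integral_le_upperExpectation {f : Ω → ℝ} {C : ℝ}
    (hf : AlmostSurely 𝔓 fun ω => |f ω| ≤ C) {P : ProbabilityMeasure Ω} (hP : P ∈ 𝔓) :
    ∫ ω, f ω ∂(P : Measure Ω) ≤ upperExpectation 𝔓 f :=
  le_csSup (bddAbove_image_integral hf) ⟨P, hP, rfl⟩

theorem upperExpectation_le (hne : 𝔓.Nonempty) {f : Ω → ℝ} {C : ℝ}
    (h : ∀ P ∈ 𝔓, ∫ ω, f ω ∂(P : Measure Ω) ≤ C) : upperExpectation 𝔓 f ≤ C := by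
  refine csSup_le (hne.image _) ?_
  rintro _ ⟨P, hP, rfl⟩
  exact h P hP

theorem upperExpectation_congr {f g : Ω → ℝ} (h : AlmostSurely 𝔓 fun ω => f ω = g ω) :
    upperExpectation 𝔓 f = upperExpectation 𝔓 g :=
  congrArg sSup (Set.image_congr fun P hP => integral_congr_ae (h P hP))

/-- An upper expectation commutes with nonnegative affine maps, so centring `f` at its upper
expectation yields upper expectation zero. -/
theorem upperExpectation_mul_sub_self (hne : 𝔓.Nonempty) {f : Ω → ℝ} {C : ℝ} (hf : Measurable f)
    (hC : AlmostSurely 𝔓 fun ω => |f ω| ≤ C) {a : ℝ} (ha : 0 ≤ a) :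
    upperExpectation 𝔓 (fun ω => a * (f ω - upperExpectation 𝔓 f)) = 0 := by
  set c := upperExpectation 𝔓 f with hc
  have hmap := Monotone.map_csSup_of_continuousAt (f := fun x : ℝ => a * (x - c))
    (A := (fun P : ProbabilityMeasure Ω => ∫ ω, f ω ∂(P : Measure Ω)) '' 𝔓)
    (by fun_prop) (fun x y hxy => by dsimp only; gcongr) (hne.image _)
    (bddAbove_image_integral hC)
  have h0 : a * (sSup ((fun P : ProbabilityMeasure Ω => ∫ ω, f ω ∂(P : Measure Ω)) '' 𝔓) - c)
      = 0 := by rw [hc, upperExpectation]; simp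
  rw [← h0, hmap, Set.image_image, upperExpectation]
  refine congrArg sSup (Set.image_congr fun P hP => ?_)
  have hint : Integrable f (P : Measure Ω) := .of_bound hf.aestronglyMeasurable C (hC P hP)
  rw [integral_const_mul, integral_sub hint (integrable_const _)]
  simp

variable {d : ℕ}

theorem lipschitzWith_upperExpectation_inner (hne : 𝔓.Nonempty)
    {X : Ω → EuclideanSpace ℝ (Fin d)} (hX : Measurable X) {M : ℝ}
    (hb : AlmostSurely 𝔓 fun ω => ‖X ω‖ ≤ M) :
    LipschitzWith M.toNNReal fun p => upperExpectation 𝔓 fun ω => inner ℝ p (X ω) := by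
  have hi (p : EuclideanSpace ℝ (Fin d)) : AlmostSurely 𝔓 fun ω => |inner ℝ p (X ω)| ≤ ‖p‖ * M :=
    fun P hP => (hb P hP).mono fun ω hω => (abs_real_inner_le_norm _ _).trans (by gcongr)
  have hint (p : EuclideanSpace ℝ (Fin d)) {P : ProbabilityMeasure Ω} (hP : P ∈ 𝔓) :
      Integrable (fun ω => inner ℝ p (X ω)) (P : Measure Ω) :=
    .of_bound (by fun_prop) _ (hi p P hP)
  refine LipschitzWith.of_le_add_mul _ fun p q => upperExpectation_le hne fun P hP => ?_
  have h1 := (abs_le.1 (abs_integral_le_of_almostSurely (hi (p - q)) hP)).2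
  simp only [inner_sub_left] at h1
  rw [integral_sub (hint p hP) (hint q hP), mul_comm, ← dist_eq_norm] at h1
  have h2 := integral_le_upperExpectation (hi q) hP
  have h3 : M * dist p q ≤ M.toNNReal * dist p q := by
    gcongr; exact Real.le_coe_toNNReal M
  linarith

/-! ### Conditional means under independence -/

variable {n : ℕ} {X : Fin n → Ω → EuclideanSpace ℝ (Fin d)}

/-- Under each `P ∈ 𝔓`, the variable `⟨p, X i⟩` centred at its upper expectation has nonpositive
mean against every nonnegative bounded Lipschitz function of the earlier variables. Independence
turns the upper expectation of the product into an iterated one, whose inner part vanishes by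
`upperExpectation_mul_sub_self`. -/
theorem Independent.integral_mul_inner_sub_nonpos (hindep : Independent 𝔓 X)
    (hX : ∀ i, Measurable (X i)) {M : ℝ} (hb : ∀ i, AlmostSurely 𝔓 fun ω => ‖X i ω‖ ≤ M)
    {P : ProbabilityMeasure Ω} (hP : P ∈ 𝔓) (i : Fin n) (p : EuclideanSpace ℝ (Fin d))
    (φ : BddLip (Fin (i : ℕ) → EuclideanSpace ℝ (Fin d))) (hφ : ∀ x, 0 ≤ φ.1 x) :
    ∫ ω, φ.1 (fun j => X (Fin.castLE i.isLt.le j) ω) *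
      (inner ℝ p (X i ω) - upperExpectation 𝔓 fun ω => inner ℝ p (X i ω)) ∂(P : Measure Ω) ≤ 0 := by
  set c := upperExpectation 𝔓 fun ω => inner ℝ p (X i ω)
  set R : ℝ := ‖p‖ * M
  have hi : AlmostSurely 𝔓 fun ω => |inner ℝ p (X i ω)| ≤ R :=
    fun P hP => (hb i P hP).mono fun ω hω =>
      (abs_real_inner_le_norm _ _).trans (mul_le_mul_of_nonneg_left hω (norm_nonneg p))
  have hmeas : Measurable fun ω => (inner ℝ p (X i ω) : ℝ) := by fun_prop
  have hzero (a : ℝ) (ha : 0 ≤ a) :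
      upperExpectation 𝔓 (fun ω => a * (inner ℝ p (X i ω) - c)) = 0 :=
    upperExpectation_mul_sub_self ⟨P, hP⟩ hmeas hi ha
  obtain ⟨C, hC⟩ := φ.2.2
  have hbd : AlmostSurely 𝔓 fun ω =>
      |φ.1 (fun j => X (Fin.castLE i.isLt.le j) ω) * (inner ℝ p (X i ω) - c)|
        ≤ C * (R + |c|) := fun P hP => (hi P hP).mono fun ω hω => by
    rw [abs_mul]
    exact mul_le_mul (hC _) ((norm_sub_le _ c).trans (add_le_add hω le_rfl)) (abs_nonneg _)
      ((abs_nonneg _).trans (hC 0))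
  refine (integral_le_upperExpectation hbd hP).trans_eq ?_
  rcases Nat.eq_zero_or_pos (i : ℕ) with h0 | hpos
  · -- before time `0` nothing has been observed, so `φ` is evaluated at a single point
    have : IsEmpty (Fin (i : ℕ)) := by rw [h0]; infer_instance
    have hconst (ω : Ω) : φ.1 (fun j => X (Fin.castLE i.isLt.le j) ω) = φ.1 0 :=
      congrArg _ (Subsingleton.elim _ _)
    simp only [hconst]
    exact hzero _ (hφ 0)
  · -- the linear form is truncated at `R`, which makes the test function bounded
    let clip : EuclideanSpace ℝ (Fin d) → ℝ := fun y => max (-R) (min R (inner ℝ p y)) - c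
    have hclip : clip ∈ BddLip (EuclideanSpace ℝ (Fin d)) := by
      refine ⟨⟨‖innerSL ℝ p‖₊, ?_⟩, |R| + |c|, fun y => ?_⟩
      · have := (((innerSL ℝ p).lipschitz.const_min R).const_max (-R)).sub
          (LipschitzWith.const c)
        simpa [clip] using this
      · refine (norm_sub_le _ c).trans (add_le_add (abs_le.2 ⟨?_, ?_⟩) le_rfl)
        · exact (neg_le_neg (le_abs_self R)).trans (le_max_left _ _)
        · exact max_le (neg_le_abs R) ((min_le_left _ _).trans (le_abs_self R))
    have hclip_eq : AlmostSurely 𝔓 fun ω => clip (X i ω) = inner ℝ p (X i ω) - c :=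
      fun P hP => (hi P hP).mono fun ω hω => by
        have := abs_le.1 hω
        simp only [clip]
        rw [min_eq_right this.2, max_eq_right this.1]
    let ψ : BddLip ((Fin (i : ℕ) → EuclideanSpace ℝ (Fin d)) × EuclideanSpace ℝ (Fin d)) :=
      ⟨fun z => φ.1 z.1 * clip z.2,
        BddLip.mul_mem (BddLip.comp_mem φ.2 LipschitzWith.prod_fst)
          (BddLip.comp_mem hclip LipschitzWith.prod_snd)⟩
    have hψ (x : Fin (i : ℕ) → EuclideanSpace ℝ (Fin d)) :
        upperExpectation 𝔓 (fun ω' => ψ.1 (x, X i ω')) = 0 :=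
      (upperExpectation_congr fun P hP => (hclip_eq P hP).mono fun ω hω => by
        show φ.1 x * clip (X i ω) = _
        rw [hω]).trans (hzero _ (hφ x))
    have hind := hindep i hpos ψ
    simp only [hψ] at hind
    refine (upperExpectation_congr fun P hP => (hclip_eq P hP).mono fun ω hω => ?_).trans
      (hind.trans ?_)
    · show _ = φ.1 (fun j => X (Fin.castLE i.isLt.le j) ω) * clip (X i ω)
      rw [hω]
    · simpa using hzero 0 le_rfl

/-- Under each `P ∈ 𝔓`, the conditional mean of `X i` given the earlier variables lies in the
expectation set of `X i`: the inequalities defining that set hold almost surely for countably many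
directions `p`, and both sides are continuous in `p`. -/
theorem Independent.condExp_mem_expectationSet (hindep : Independent 𝔓 X)
    (hX : ∀ i, Measurable (X i)) {M : ℝ} (hb : ∀ i, AlmostSurely 𝔓 fun ω => ‖X i ω‖ ≤ M)
    {P : ProbabilityMeasure Ω} (hP : P ∈ 𝔓) (i : Fin n) :
    ∀ᵐ ω ∂(P : Measure Ω),
      ((P : Measure Ω)[X i | past (extendZero X) i]) ω ∈ expectationSet 𝔓 (X i) := by
  have hW : pastVector (extendZero X) i = fun ω j => X (Fin.castLE i.isLt.le j) ω := by
    funext ω j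
    exact congrFun (extendZero_coe X (Fin.castLE i.isLt.le j)) ω
  have hWm : Measurable (pastVector (extendZero X) i) := by
    rw [hW]; exact measurable_pi_lambda _ fun j => hX _
  have hint : Integrable (X i) (P : Measure Ω) :=
    .of_bound (hX i).aestronglyMeasurable M (hb i P hP)
  have hp (p : EuclideanSpace ℝ (Fin d)) : ∀ᵐ ω ∂(P : Measure Ω),
      inner ℝ (((P : Measure Ω)[X i | past (extendZero X) i]) ω) p ≤
        upperExpectation 𝔓 fun ω => inner ℝ p (X i ω) := by
    have h1 := condExp_comap_le_of_forall_bddLip (μ := (P : Measure Ω)) hWm (K := ‖p‖ * M)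
      (Y := fun ω => inner ℝ p (X i ω)) (c := upperExpectation 𝔓 fun ω => inner ℝ p (X i ω))
      (by fun_prop)
      ((hb i P hP).mono fun ω hω => (norm_inner_le_norm _ _).trans (by gcongr))
      (fun φ hφ => by
        rw [hW]
        exact hindep.integral_mul_inner_sub_nonpos hX hb hP i p φ hφ)
    have h2 := (innerSL ℝ p).comp_condExp_comm (m := past (extendZero X) i) hint
    filter_upwards [h1, h2] with ω h1 h2
    rw [real_inner_comm]
    exact (show inner ℝ p _ = _ from h2).trans_le h1
  obtain ⟨D, hDc, hD⟩ := TopologicalSpace.exists_countable_dense (EuclideanSpace ℝ (Fin d))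
  filter_upwards [(ae_ball_iff hDc).2 fun p _ => hp p] with ω hω p
  have hcont := (lipschitzWith_upperExpectation_inner ⟨P, hP⟩ (hX i) (hb i)).continuous
  have hclosed : IsClosed {p | inner ℝ (((P : Measure Ω)[X i | past (extendZero X) i]) ω) p ≤
      upperExpectation 𝔓 fun ω => inner ℝ p (X i ω)} :=
    isClosed_le (by fun_prop) hcont
  have := hclosed.closure_subset_iff.2 (show D ⊆ _ from hω)
  rw [hD.closure_eq] at this
  exact this (Set.mem_univ p)

end Upper

theorem measurable_of_memLVec {Ω : Type*} [MetricSpace Ω] [MeasurableSpace Ω]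
    {𝔓 : Set (ProbabilityMeasure Ω)} {d : ℕ} {p : ℝ≥0∞} {X : Ω → EuclideanSpace ℝ (Fin d)}
    (hX : MemLVec 𝔓 p X) : Measurable X :=
  (WithLp.measurable_toLp 2 _).comp (measurable_pi_lambda _ fun k => (hX k).1)

end SublinearExp

theorem mainTheorem2 {Ω : Type*} [MetricSpace Ω] [CompleteSpace Ω]
    [TopologicalSpace.SeparableSpace Ω] [MeasurableSpace Ω] [BorelSpace Ω]
    (𝔼 : SublinearExp.RegularSublinearExpectation Ω)
    (𝔓 : Set (ProbabilityMeasure Ω)) (h𝔓 : 𝔼.IsRepresentedBy 𝔓)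
    (n d : ℕ) (hn : 0 < n) (X : Fin n → Ω → EuclideanSpace ℝ (Fin d))
    (hX : ∀ i, SublinearExp.MemLVec 𝔓 2 (X i))
    (hindep : SublinearExp.Independent 𝔓 X)
    (M : ℝ) (hM : 0 < M)
    (hbound : ∀ i, SublinearExp.AlmostSurely 𝔓 (fun ω => ‖X i ω‖ ≤ M))
    (t : ℝ) (ht : 0 < t) :
    SublinearExp.upperCapacity 𝔓
        {ω | t < Metric.infDist ((1 / (n : ℝ)) • ∑ i, X i ω)
          (SublinearExp.minkowskiAverage 𝔓 X)} ≤
      ENNReal.ofReal (2 * 5 ^ d * Real.exp (-((n : ℝ) * t ^ 2 / (32 * M ^ 2)))) := by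
  have hXm (i : Fin n) : Measurable (X i) := SublinearExp.measurable_of_memLVec (hX i)
  have hn' : (0 : ℝ) < n := by exact_mod_cast hn
  refine iSup₂_le fun P hP => ?_
  set Z := SublinearExp.extendZero X with hZdef
  have hZX (i : Fin n) : Z i = X i := SublinearExp.extendZero_coe X i
  have hZm (j : ℕ) : Measurable (Z j) := by
    by_cases h : j < n
    · simpa only [hZX ⟨j, h⟩] using hXm ⟨j, h⟩
    · rw [show Z j = 0 by simp [hZdef, SublinearExp.extendZero, h]]
      exact measurable_zero
  have hZb (j : ℕ) : ∀ᵐ ω ∂(P : Measure Ω), ‖Z j ω‖ ≤ M := by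
    by_cases h : j < n
    · exact (hZX ⟨j, h⟩) ▸ hbound ⟨j, h⟩ P hP
    · simp [hZdef, SublinearExp.extendZero, h, hM.le]
  have hθ := ae_all_iff.2 fun i => hindep.condExp_mem_expectationSet hXm hbound hP i
  have key := SublinearExp.measure_lt_norm_sum_sub_condExp_le hZm hM hZb hn ht
  have hsub : ∀ᵐ ω ∂(P : Measure Ω),
      t < Metric.infDist ((1 / (n : ℝ)) • ∑ i, X i ω) (SublinearExp.minkowskiAverage 𝔓 X) →
      n * t < ‖∑ i ∈ Finset.range n,
        (Z i ω - ((P : Measure Ω)[Z i | SublinearExp.past Z i]) ω)‖ := by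
    filter_upwards [hθ] with ω hω hlt
    -- the mean of the conditional expectations is a point of the Minkowski average
    have hdist := hlt.trans_le (Metric.infDist_le_dist_of_mem
      (x := (1 / (n : ℝ)) • ∑ i, X i ω) ⟨_, hω, rfl⟩)
    rw [dist_eq_norm, ← smul_sub, ← Finset.sum_sub_distrib, norm_smul,
      Real.norm_of_nonneg (by positivity), one_div, inv_mul_eq_div, lt_div_iff₀ hn'] at hdist
    rw [Finset.sum_range, mul_comm]
    simpa only [hZX] using hdist
  have hfin : Module.finrank ℝ (EuclideanSpace ℝ (Fin d)) = d := by simp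
  rw [hfin] at key
  calc (P : Measure Ω) {ω | t < Metric.infDist ((1 / (n : ℝ)) • ∑ i, X i ω)
          (SublinearExp.minkowskiAverage 𝔓 X)}
      ≤ (P : Measure Ω) {ω | n * t < ‖∑ i ∈ Finset.range n,
          (Z i ω - ((P : Measure Ω)[Z i | SublinearExp.past Z i]) ω)‖} := measure_mono_ae hsub
    _ ≤ ENNReal.ofReal (5 ^ d * Real.exp (-((n : ℝ) * t ^ 2 / (32 * M ^ 2)))) := by
        rw [← ofReal_measureReal (measure_ne_top _ _)]
        exact ENNReal.ofReal_le_ofReal key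
    _ ≤ _ := by
        refine ENNReal.ofReal_le_ofReal ?_
        rw [mul_assoc]
        exact le_mul_of_one_le_left (by positivity) one_le_two
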